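/- Let $0\le k<n$, let $A\in\mathbb{R}^{n\times n}$ be symmetric positive semidefinite with eigenvalues $\lambda_1(A)\ge\dots\ge\lambda_n(A)\ge 0$ (with multiplicity), and let $A=U\,\mathrm{diag}(\lambda_1(A),\dots,\lambda_n(A))\,U^\top$ be an eigendecomposition with $U=[u_1,\dots,u_n]$ orthogonal. Put $U_1=[u_1,\dots,u_k]$ and $U_2=[u_{k+1},\dots,u_n]$. Let $0\le\epsilon<1$ and let $Q\in\mathbb{R}^{n\times k}$ have orthonormal columns ($Q^\top Q=I_k$) and be of the form $$Q=U_1+\epsilon^2U_1M+\epsilon U_2N,\qquad M\in\mathbb{R}^{k\times k},\quad N\in\mathbb{R}^{(n-k)\times k},\quad \|M\|_2\le1,\quad \|N\|_2\le 1,$$ where $\|\cdot\|_2$ is the spectral norm; thus $\mathrm{span}(Q)$ is an $\epsilon$-approximation of the dominant invariant subspace $\mathrm{span}(U_1)$, i.e. $\|U_2^\top Q\|_2\le\epsilon$. Write $\lambda_i(\cdot)$ and $\sigma_i(\cdot)$ for the $i$-th largest eigenvalue of a symmetric matrix and the $i$-th largest singular value of a matrix, $\dagger$ for the Moore–Penrose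 pseudoinverse, and $A\langle Q\rangle=AQ(Q^\top AQ)^{\dagger}Q^\top A$ for the Nyström approximation. Let $$C_{RR}=2+\epsilon^2+\frac{\lambda_{k+1}(A)}{\lambda_1(A)}$$ (the ratio being read as $0$ if $A=0$). Then $C_{RR}\le 4$, and for each $i=1,\dots,k$ the SVD-extract and Rayleigh–Ritz errors satisfy $$|\lambda_i(A)-\sigma_i(AQ)|\le|\lambda_i(A)-\lambda_i(Q^\top AQ)|\le C_{RR}\,\epsilon^2\lambda_1(A).$$ If moreover $\lambda_i(A)>0$ and $$\alpha_i:=1-\frac{3\lambda_{k+1}(A)+3\epsilon^2(\lambda_1(A)-\lambda_{k+1}(A))}{\lambda_i(A)}>0,$$ then the Nyström error satisfies $$|\lambda_i(A)-\lambda_i(A\langle Q\rangle)|\le C_{Nys,i}\left(\epsilon^2\lambda_{k+1}(A)+\epsilon^4(\lambda_1(A)-\lambda_{k+1}(A))\right),$$ where $$C_{Nys,i}=\left(\frac{\lambda_1(A)(1+\epsilon^2)+\lambda_{k+1}(A)\left(1+\dfrac{\epsilon^2}{1+\sqrt{1-\epsilon^2}}\right)}{\alpha_i\,\lambda_i(A)}\right)^{2}.$$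 -/

import Mathlib

open scoped Matrix Matrix.Norms.L2Operator

namespace NystromEig

noncomputable section

/-- The eigenvalues of a symmetric real `m × m` matrix, listed in non-increasing order with
multiplicity. The index starts at `0`, so `eigval hB ⟨0, _⟩` is the largest eigenvalue. -/
def eigval {m : ℕ} {B : Matrix (Fin m) (Fin m) ℝ} (hB : B.IsHermitian) (i : Fin m) : ℝ :=
  hB.eigenvalues₀ (Fin.cast (Fintype.card_fin m).symm i)

/-- The `i`-th largest singular value (index starting at `0`) of a real `m × l` matrix. -/
def singval {m l : ℕ} (B : Matrix (Fin m) (Fin l) ℝ) (i : ℕ) : ℝ :=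
  (Matrix.toEuclideanLin B).singularValues i

/-- The pseudoinverse `V diag(σ₁⁻¹, …, σᵣ⁻¹, 0, …, 0) Wᵀ` of a matrix with singular value
decomposition `B = W Σ Vᵀ`. Here `V` is an orthogonal matrix of eigenvectors of `Bᵀ B`, the
eigenvalues of `Bᵀ B` are the `σᵢ²`, and `σᵢ⁻¹ wᵢᵀ = σᵢ⁻² (B vᵢ)ᵀ` whenever `σᵢ ≠ 0`
(note that `0⁻¹ = 0`). -/
def pinv {m l : ℕ} (B : Matrix (Fin m) (Fin l) ℝ) : Matrix (Fin l) (Fin m) ℝ :=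
  let h := Matrix.isHermitian_conjTranspose_mul_self B
  let V : Matrix (Fin l) (Fin l) ℝ := (h.eigenvectorUnitary).val
  V * Matrix.diagonal (fun i => (h.eigenvalues i)⁻¹) * Vᵀ * Bᵀ

/-- The four Penrose equations. -/
structure IsPenrose {m l : ℕ} (B : Matrix (Fin m) (Fin l) ℝ) (P : Matrix (Fin l) (Fin m) ℝ) :
    Prop where
  bpb : B * P * B = B
  pbp : P * B * P = P
  bp : (B * P)ᵀ = B * P
  pb : (P * B)ᵀ = P * B

theorem pinv_isPenrose {m l : ℕ} (B : Matrix (Fin m) (Fin l) ℝ) : IsPenrose B (pinv B) := by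
  set h := Matrix.isHermitian_conjTranspose_mul_self B with hh
  set V : Matrix (Fin l) (Fin l) ℝ := (h.eigenvectorUnitary).val with hV
  set D : Matrix (Fin l) (Fin l) ℝ := Matrix.diagonal h.eigenvalues with hD
  set E : Matrix (Fin l) (Fin l) ℝ := Matrix.diagonal (fun i => (h.eigenvalues i)⁻¹) with hE
  have hVV : Vᵀ * V = 1 := by
    have := Unitary.coe_star_mul_self h.eigenvectorUnitary
    rwa [Matrix.star_eq_conjTranspose, Matrix.conjTranspose_eq_transpose_of_trivial] at this
  have hC : Bᵀ * B = V * D * Vᵀ := by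
    have := h.spectral_theorem
    rw [Unitary.conjStarAlgAut_apply] at this
    exact this
  have hP : pinv B = V * E * Vᵀ * Bᵀ := rfl
  set G := V * E * Vᵀ with hG
  set C := V * D * Vᵀ with hCdef
  have hGT : Gᵀ = G := by
    rw [hG, hE]; simp [Matrix.transpose_mul, Matrix.mul_assoc]
  have hCT : Cᵀ = C := by
    rw [hCdef, hD]; simp [Matrix.transpose_mul, Matrix.mul_assoc]
  have mulV : ∀ X Y : Matrix (Fin l) (Fin l) ℝ,
      (V * X * Vᵀ) * (V * Y * Vᵀ) = V * (X * Y) * Vᵀ := by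
    intro X Y
    calc (V * X * Vᵀ) * (V * Y * Vᵀ) = V * X * (Vᵀ * V) * (Y * Vᵀ) := by
          simp only [Matrix.mul_assoc]
      _ = _ := by rw [hVV]; simp only [Matrix.mul_assoc, Matrix.one_mul]
  have hCG : C * G = G * C := by
    rw [hCdef, hG, mulV, mulV, hD, hE, Matrix.diagonal_mul_diagonal,
      Matrix.diagonal_mul_diagonal]
    simp only [mul_comm]
  have hGCG : G * C * G = G := by
    rw [hCdef, hG, mulV, mulV, hD, hE, Matrix.diagonal_mul_diagonal,
      Matrix.diagonal_mul_diagonal]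
    congr 3
    funext i
    have hz := mul_inv_mul_cancel (h.eigenvalues i)⁻¹
    rw [inv_inv] at hz
    exact hz
  have hCGC : C * G * C = C := by
    rw [hCdef, hG, mulV, mulV, hD, hE, Matrix.diagonal_mul_diagonal,
      Matrix.diagonal_mul_diagonal]
    congr 3
    funext i
    exact mul_inv_mul_cancel _
  have hPB : pinv B * B = G * C := by rw [hP, Matrix.mul_assoc, hC]
  refine ⟨?_, ?_, ?_, ?_⟩
  · have hz : B * (G * C) - B = 0 := by
      rw [← Matrix.conjTranspose_mul_self_eq_zero, Matrix.conjTranspose_eq_transpose_of_trivial]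
      have e1 : (B * (G * C) - B)ᵀ = C * G * Bᵀ - Bᵀ := by
        rw [Matrix.transpose_sub, Matrix.transpose_mul, Matrix.transpose_mul, hGT, hCT]
      rw [e1]
      have e2 : (C * G * Bᵀ - Bᵀ) * (B * (G * C) - B)
          = C * G * (Bᵀ * B) * (G * C) - C * G * (Bᵀ * B) - (Bᵀ * B) * (G * C) + Bᵀ * B := by
        simp only [Matrix.sub_mul, Matrix.mul_sub, Matrix.mul_assoc]
        abel
      rw [e2, hC, hCGC, ← Matrix.mul_assoc, hCGC]
      abel
    rw [Matrix.mul_assoc, hPB]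
    exact sub_eq_zero.mp hz
  · rw [hPB, hP, ← Matrix.mul_assoc, hGCG]
  · rw [hP]
    simp only [Matrix.transpose_mul, Matrix.transpose_transpose, hGT, Matrix.mul_assoc]
  · rw [hPB, Matrix.transpose_mul, hGT, hCT, hCG]

theorem IsPenrose.eq {m l : ℕ} {B : Matrix (Fin m) (Fin l) ℝ} {P R : Matrix (Fin l) (Fin m) ℝ}
    (hP : IsPenrose B P) (hR : IsPenrose B R) : P = R := by
  have h1 : B * P = B * R := by
    calc B * P = (B * R * B) * P := by rw [hR.bpb]
      _ = (B * R)ᵀ * (B * P)ᵀ := by rw [hR.bp, hP.bp, Matrix.mul_assoc (B * R)]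
      _ = ((B * P * B) * R)ᵀ := by rw [← Matrix.transpose_mul, Matrix.mul_assoc (B * P)]
      _ = B * R := by rw [hP.bpb, hR.bp]
  have h2 : P * B = R * B := by
    calc P * B = P * (B * R * B) := by rw [hR.bpb]
      _ = (P * B)ᵀ * (R * B)ᵀ := by rw [hR.pb, hP.pb]; simp only [Matrix.mul_assoc]
      _ = (R * (B * P * B))ᵀ := by rw [← Matrix.transpose_mul]; simp only [Matrix.mul_assoc]
      _ = R * B := by rw [hP.bpb, hR.pb]
  calc P = P * B * P := hP.pbp.symm
    _ = R * B * R := by rw [h2, Matrix.mul_assoc, h1, Matrix.mul_assoc]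
    _ = R := hR.pbp

theorem pinv_isHermitian {m : ℕ} {B : Matrix (Fin m) (Fin m) ℝ} (hB : B.IsHermitian) :
    (pinv B).IsHermitian := by
  have hBT : Bᵀ = B := by
    rw [← Matrix.conjTranspose_eq_transpose_of_trivial]; exact hB
  have h := pinv_isPenrose B
  have h' : IsPenrose B (pinv B)ᵀ := by
    refine ⟨?_, ?_, ?_, ?_⟩
    · have := congrArg Matrix.transpose h.bpb
      simpa only [Matrix.transpose_mul, hBT, Matrix.mul_assoc] using this
    · have := congrArg Matrix.transpose h.pbp
      simpa only [Matrix.transpose_mul, hBT, Matrix.mul_assoc] using this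
    · have := h.pb
      rw [Matrix.transpose_mul, hBT] at this
      rw [Matrix.transpose_mul, Matrix.transpose_transpose, hBT]
      exact this.symm
    · have := h.bp
      rw [Matrix.transpose_mul, hBT] at this
      rw [Matrix.transpose_mul, Matrix.transpose_transpose, hBT]
      exact this.symm
  change (pinv B)ᴴ = pinv B
  rw [Matrix.conjTranspose_eq_transpose_of_trivial]
  exact h'.eq h

/-- The Nyström approximation `A⟨X⟩ = A X (Xᵀ A X)† Xᵀ A`. -/
def nystrom {n k : ℕ} (A : Matrix (Fin n) (Fin n) ℝ) (X : Matrix (Fin n) (Fin k) ℝ) :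
    Matrix (Fin n) (Fin n) ℝ :=
  A * X * pinv (Xᵀ * A * X) * Xᵀ * A

theorem compress_isHermitian {n k : ℕ} {A : Matrix (Fin n) (Fin n) ℝ} (hA : A.IsHermitian)
    (X : Matrix (Fin n) (Fin k) ℝ) : (Xᵀ * A * X).IsHermitian := by
  rw [← Matrix.conjTranspose_eq_transpose_of_trivial]
  exact Matrix.isHermitian_conjTranspose_mul_mul X hA

theorem nystrom_isHermitian {n k : ℕ} {A : Matrix (Fin n) (Fin n) ℝ} (hA : A.IsHermitian)
    (X : Matrix (Fin n) (Fin k) ℝ) : (nystrom A X).IsHermitian := by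
  have hAT : Aᵀ = A := by
    rw [← Matrix.conjTranspose_eq_transpose_of_trivial]; exact hA
  have hP : (pinv (Xᵀ * A * X))ᵀ = pinv (Xᵀ * A * X) := by
    rw [← Matrix.conjTranspose_eq_transpose_of_trivial]
    exact pinv_isHermitian (compress_isHermitian hA X)
  change (nystrom A X)ᴴ = nystrom A X
  rw [Matrix.conjTranspose_eq_transpose_of_trivial, nystrom]
  simp only [Matrix.transpose_mul, Matrix.transpose_transpose, hAT, hP]
  simp only [Matrix.mul_assoc]

/-- The first `k` columns of an `n × n` matrix. -/
def leadCols {n k : ℕ} (hk : k < n) (U : Matrix (Fin n) (Fin n) ℝ) :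
    Matrix (Fin n) (Fin k) ℝ :=
  fun r c => U r ⟨c, by omega⟩

/-- The last `n - k` columns of an `n × n` matrix. -/
def tailCols {n k : ℕ} (hk : k < n) (U : Matrix (Fin n) (Fin n) ℝ) :
    Matrix (Fin n) (Fin (n - k)) ℝ :=
  fun r c => U r ⟨k + c, by omega⟩

/-- The number `αᵢ`, with `l₁ = λ₁`, `lk = λ_{k+1}` and `li = λᵢ`. -/
def alpha (ε l₁ lk li : ℝ) : ℝ := 1 - (3 * lk + 3 * ε ^ 2 * (l₁ - lk)) / li

/-- The constant of the Rayleigh–Ritz bound, with `l₁ = λ₁` and `lk = λ_{k+1}`. -/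
def cRR (ε l₁ lk : ℝ) : ℝ := 2 + ε ^ 2 + lk / l₁

/-- The constant of the Nyström bound, with `l₁ = λ₁`, `lk = λ_{k+1}` and `li = λᵢ`. -/
def cNys (ε l₁ lk li : ℝ) : ℝ :=
  ((l₁ * (1 + ε ^ 2) + lk * (1 + ε ^ 2 * (1 / (1 + √(1 - ε ^ 2))))) /
    (alpha ε l₁ lk li * li)) ^ 2

end

end NystromEig

/-! Everything reduces to one half of Courant–Fischer: if the quadratic form is at least `c‖v‖²` on
a subspace of dimension greater than `i` (indices start at zero), then `c` is at most the `i`-th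
eigenvalue. Upper bounds come from the subspace that realises an eigenvalue of the compressed or
approximated matrix.

In the coordinates `Uᵀ v`, the form of `A` is a weighted sum of squares. A vector `Q x` has tail
mass at most `ε²‖x‖²` by the bound on `N`, hence lead mass at least `(1 - ε²)‖x‖²` because `Q` is an
isometry. Cauchy–Schwarz and interlacing give `λᵢ(QᵀAQ) ≤ σᵢ(AQ) ≤ λᵢ(A)`; the bound on `M` gives
`λᵢ(QᵀAQ) ≥ λᵢ - 2ε²λ₁`, and `2 ≤ C_RR`.

For Nyström, `A⟨Q⟩ ≤ A` in the Loewner order. Testing its form on vectors `A Q x` yields the sharper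
error `λ_{k+1} ε² / (1 - ε²)` (`le_eigval_nystrom`), and `1 / (1 - ε²) ≤ C_Nys` (`one_div_le_cNys`);
the `ε⁴` term is then only slack. -/

namespace NystromEig

open Module Matrix

/-! ### Dimension counting -/

section Subspaces

variable {E : Type*} [AddCommGroup E] [Module ℝ E]

/-- The vectors `x` for which `f x` is supported on the coordinates `0, …, i`. -/
def supportedUpTo {m : ℕ} (f : E →ₗ[ℝ] (Fin m → ℝ)) (i : Fin m) : Submodule ℝ E :=
  LinearMap.ker ((LinearMap.funLeft ℝ ℝ (Subtype.val : {j : Fin m // i < j} → Fin m)) ∘ₗ f)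

theorem mem_supportedUpTo {m : ℕ} {f : E →ₗ[ℝ] (Fin m → ℝ)} {i : Fin m} {x : E} :
    x ∈ supportedUpTo f i ↔ ∀ j, i < j → f x j = 0 := by
  simp [supportedUpTo, funext_iff, LinearMap.funLeft_apply]

theorem lt_finrank_supportedUpTo [FiniteDimensional ℝ E] {m : ℕ} (hm : finrank ℝ E = m) (f : E →ₗ[ℝ] (Fin m → ℝ))
    (i : Fin m) : (i : ℕ) < finrank ℝ (supportedUpTo f i) := by
  set g := (LinearMap.funLeft ℝ ℝ (Subtype.val : {j : Fin m // i < j} → Fin m)) ∘ₗ f with hg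
  have h1 := g.finrank_range_add_finrank_ker
  have h2 : finrank ℝ (LinearMap.range g) ≤ m - 1 - i := by
    refine (Submodule.finrank_le _).trans ?_
    rw [finrank_fintype_fun_eq_card, Fintype.card_subtype, Finset.filter_lt_eq_Ioi, Fin.card_Ioi]
  have h3 : supportedUpTo f i = LinearMap.ker g := rfl
  rw [h3]
  have := i.isLt
  omega

/-- Only `i` linear conditions are imposed on a space of dimension greater than `i`. This replaces
the intersection of subspaces in min-max arguments. -/
theorem exists_ne_zero_vanishing_below [FiniteDimensional ℝ E] {m : ℕ} (f : E →ₗ[ℝ] (Fin m → ℝ)) (i : Fin m)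
    (W : Submodule ℝ E) (hW : (i : ℕ) < finrank ℝ W) :
    ∃ v ∈ W, v ≠ 0 ∧ ∀ j, j < i → f v j = 0 := by
  set g := (LinearMap.funLeft ℝ ℝ (Subtype.val : {j : Fin m // j < i} → Fin m)) ∘ₗ f ∘ₗ
    W.subtype with hg
  have h : LinearMap.ker g ≠ ⊥ := by
    apply LinearMap.ker_ne_bot_of_finrank_lt
    rwa [finrank_fintype_fun_eq_card, Fintype.card_subtype, Finset.filter_gt_eq_Iio, Fin.card_Iio]
  obtain ⟨v, hv, hv0⟩ := Submodule.exists_mem_ne_zero_of_ne_bot h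
  refine ⟨v, v.2, by simpa using hv0, fun j hj => ?_⟩
  exact congrFun (LinearMap.mem_ker.mp hv) ⟨j, hj⟩

end Subspaces

/-! ### Min-max for symmetric operators -/

section Symmetric

variable {E : Type*} [NormedAddCommGroup E] [InnerProductSpace ℝ E] [FiniteDimensional ℝ E]
  {m : ℕ} {T : E →ₗ[ℝ] E}

theorem inner_apply_eq_sum (hT : T.IsSymmetric) (hm : finrank ℝ E = m) (v : E) :
    inner ℝ v (T v) =
      ∑ j, hT.eigenvalues hm j * ((hT.eigenvectorBasis hm).repr v j) ^ 2 := by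
  rw [← (hT.eigenvectorBasis hm).repr.inner_map_map, PiLp.inner_apply]
  refine Finset.sum_congr rfl fun j _ => ?_
  rw [hT.eigenvectorBasis_apply_self_apply]
  simp
  ring

theorem norm_sq_eq_sum (hT : T.IsSymmetric) (hm : finrank ℝ E = m) (v : E) :
    ‖v‖ ^ 2 = ∑ j, ((hT.eigenvectorBasis hm).repr v j) ^ 2 := by
  rw [← (hT.eigenvectorBasis hm).repr.norm_map, EuclideanSpace.real_norm_sq_eq]

/-- The eigenvector coordinates of a vector, as a linear map. -/
noncomputable def eigenCoords (hT : T.IsSymmetric) (hm : finrank ℝ E = m) :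
    E →ₗ[ℝ] (Fin m → ℝ) :=
  (WithLp.linearEquiv 2 ℝ (Fin m → ℝ)).toLinearMap ∘ₗ
    (hT.eigenvectorBasis hm).repr.toLinearEquiv.toLinearMap

theorem eigenCoords_apply (hT : T.IsSymmetric) (hm : finrank ℝ E = m) (v : E) (j : Fin m) :
    eigenCoords hT hm v j = (hT.eigenvectorBasis hm).repr v j := rfl

theorem exists_submodule_eigenvalues_le (hT : T.IsSymmetric) (hm : finrank ℝ E = m)
    (i : Fin m) : ∃ W : Submodule ℝ E, (i : ℕ) < finrank ℝ W ∧
      ∀ v ∈ W, hT.eigenvalues hm i * ‖v‖ ^ 2 ≤ inner ℝ v (T v) := by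
  refine ⟨supportedUpTo (eigenCoords hT hm) i, lt_finrank_supportedUpTo hm _ i, fun v hv => ?_⟩
  rw [inner_apply_eq_sum hT hm, norm_sq_eq_sum hT hm, Finset.mul_sum]
  refine Finset.sum_le_sum fun j _ => ?_
  rcases le_or_gt j i with h | h
  · exact mul_le_mul_of_nonneg_right (hT.eigenvalues_antitone hm h) (sq_nonneg _)
  · rw [← eigenCoords_apply, mem_supportedUpTo.mp hv j h]
    simp

/-- By dimension, `W` contains a nonzero vector in the span of the eigenvectors of index at least
`i`, where the Rayleigh quotient is at most the `i`-th eigenvalue. -/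
theorem le_eigenvalues (hT : T.IsSymmetric) (hm : finrank ℝ E = m) (i : Fin m) (c : ℝ)
    (W : Submodule ℝ E) (hW : (i : ℕ) < finrank ℝ W)
    (h : ∀ v ∈ W, c * ‖v‖ ^ 2 ≤ inner ℝ v (T v)) : c ≤ hT.eigenvalues hm i := by
  obtain ⟨v, hvW, hv0, hv⟩ := exists_ne_zero_vanishing_below (eigenCoords hT hm) i W hW
  have hpos : 0 < ‖v‖ ^ 2 := by positivity
  refine le_of_mul_le_mul_right ((h v hvW).trans ?_) hpos
  rw [inner_apply_eq_sum hT hm, norm_sq_eq_sum hT hm, Finset.mul_sum]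
  refine Finset.sum_le_sum fun j _ => ?_
  rcases le_or_gt i j with h | h
  · exact mul_le_mul_of_nonneg_right (hT.eigenvalues_antitone hm h) (sq_nonneg _)
  · rw [← eigenCoords_apply, hv j h]
    simp

end Symmetric

/-! ### Min-max for matrices, and singular values -/

section MatrixVersions

variable {m : ℕ} {B : Matrix (Fin m) (Fin m) ℝ}

theorem eigval_antitone (hB : B.IsHermitian) : Antitone (eigval hB) :=
  fun _ _ h => hB.eigenvalues₀_antitone h

theorem norm_sq_toLp {ι : Type*} [Fintype ι] (x : ι → ℝ) : ‖WithLp.toLp 2 x‖ ^ 2 = x ⬝ᵥ x := by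
  rw [EuclideanSpace.real_norm_sq_eq]
  simp [dotProduct, sq]

theorem inner_toEuclideanLin_toLp (x : Fin m → ℝ) :
    inner ℝ (WithLp.toLp 2 x) (Matrix.toEuclideanLin B (WithLp.toLp 2 x)) = x ⬝ᵥ B *ᵥ x := by
  rw [PiLp.inner_apply]
  simp [dotProduct, mul_comm]

theorem exists_submodule_eigval_le (hB : B.IsHermitian) (i : Fin m) :
    ∃ W : Submodule ℝ (Fin m → ℝ), (i : ℕ) < finrank ℝ W ∧
      ∀ v ∈ W, eigval hB i * (v ⬝ᵥ v) ≤ v ⬝ᵥ B *ᵥ v := by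
  obtain ⟨W, hW, h⟩ := exists_submodule_eigenvalues_le (isSymmetric_toEuclideanLin_iff.mpr hB)
    finrank_euclideanSpace (Fin.cast (Fintype.card_fin m).symm i)
  set e := WithLp.linearEquiv 2 ℝ (Fin m → ℝ)
  refine ⟨W.comap e.symm.toLinearMap, ?_, fun v hv => ?_⟩
  · rw [← Submodule.map_equiv_eq_comap_symm, LinearEquiv.finrank_map_eq]
    exact hW
  · have := h _ hv
    change _ * ‖WithLp.toLp 2 v‖ ^ 2 ≤
      inner ℝ (WithLp.toLp 2 v) (Matrix.toEuclideanLin B (WithLp.toLp 2 v)) at this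
    rwa [norm_sq_toLp, inner_toEuclideanLin_toLp] at this

theorem le_eigval (hB : B.IsHermitian) (i : Fin m) (c : ℝ) (W : Submodule ℝ (Fin m → ℝ))
    (hW : (i : ℕ) < finrank ℝ W) (h : ∀ v ∈ W, c * (v ⬝ᵥ v) ≤ v ⬝ᵥ B *ᵥ v) :
    c ≤ eigval hB i := by
  set e := WithLp.linearEquiv 2 ℝ (Fin m → ℝ)
  refine le_eigenvalues (isSymmetric_toEuclideanLin_iff.mpr hB)
    finrank_euclideanSpace (Fin.cast (Fintype.card_fin m).symm i) c (W.map e.symm.toLinearMap) ?_ ?_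
  · rw [LinearEquiv.finrank_map_eq]
    exact hW
  · rintro _ ⟨v, hv, rfl⟩
    change _ * ‖WithLp.toLp 2 v‖ ^ 2 ≤
      inner ℝ (WithLp.toLp 2 v) (Matrix.toEuclideanLin B (WithLp.toLp 2 v))
    rw [norm_sq_toLp, inner_toEuclideanLin_toLp]
    exact h v hv

/-- The form version of the min-max principle for a map that is injective on the test space. -/
theorem le_eigval_of_map {p : ℕ} (hB : B.IsHermitian) (i : Fin m) (c : ℝ)
    (F : Matrix (Fin m) (Fin p) ℝ) (W : Submodule ℝ (Fin p → ℝ)) (hW : (i : ℕ) < finrank ℝ W)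
    (hF : ∀ x ∈ W, F *ᵥ x = 0 → x = 0)
    (h : ∀ x ∈ W, c * (F *ᵥ x ⬝ᵥ F *ᵥ x) ≤ F *ᵥ x ⬝ᵥ B *ᵥ F *ᵥ x) :
    c ≤ eigval hB i := by
  refine le_eigval hB i c (W.map F.mulVecLin) ?_ ?_
  · have hinj : Function.Injective (F.mulVecLin ∘ₗ W.subtype) := by
      rw [← LinearMap.ker_eq_bot, LinearMap.ker_eq_bot']
      intro x hx
      exact Subtype.ext (hF x x.2 hx)
    have := LinearMap.finrank_range_of_inj hinj
    rw [LinearMap.range_comp, Submodule.range_subtype] at this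
    rwa [this]
  · rintro _ ⟨v, hv, rfl⟩
    exact h v hv

theorem singval_nonneg {l : ℕ} (C : Matrix (Fin m) (Fin l) ℝ) (i : ℕ) : 0 ≤ singval C i :=
  LinearMap.singularValues_nonneg _ i

/-- Symmetry proofs depend on the operator, so direct rewriting is awkward; this lets `sq_singval`
identify the adjoint product with the operator of `Cᵀ * C`. -/
theorem eigenvalues_congr {E : Type*} [NormedAddCommGroup E] [InnerProductSpace ℝ E]
    [FiniteDimensional ℝ E] {S T : E →ₗ[ℝ] E} (hST : S = T) (hS : S.IsSymmetric)
    (hT : T.IsSymmetric) (hm : finrank ℝ E = m) : hS.eigenvalues hm = hT.eigenvalues hm := by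
  subst hST
  rfl

theorem sq_singval {l : ℕ} (C : Matrix (Fin m) (Fin l) ℝ) (hC : (Cᵀ * C).IsHermitian)
    (i : Fin l) : singval C i ^ 2 = eigval hC i := by
  have := (Matrix.toEuclideanLin C).sq_singularValues_fin finrank_euclideanSpace
    (Fin.cast (Fintype.card_fin l).symm i)
  refine this.trans (congrFun (eigenvalues_congr ?_ _ _ _) _)
  rw [← Matrix.toEuclideanLin_conjTranspose_eq_adjoint,
    Matrix.conjTranspose_eq_transpose_of_trivial]
  ext x
  simp

end MatrixVersions

end NystromEig

namespace NystromEig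

open Module Matrix

/-! ### Eigenvector coordinates of `A` and of `Q x` -/

section Coordinates

theorem sum_lead_add_tail {n k : ℕ} (hk : k < n) (f : Fin n → ℝ) :
    ∑ j, f j = ∑ i : Fin k, f (i.castLE hk.le) +
      ∑ c : Fin (n - k), f ⟨k + c, by omega⟩ := by
  rw [← Fintype.sum_equiv (finCongr (show k + (n - k) = n by omega))
    (fun j => f (finCongr (show k + (n - k) = n by omega) j)) f (fun _ => rfl), Fin.sum_univ_add]
  rfl

theorem dotProduct_self_mulVec_le {p q : ℕ} {N : Matrix (Fin p) (Fin q) ℝ} (hN : ‖N‖ ≤ 1)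
    (x : Fin q → ℝ) : N *ᵥ x ⬝ᵥ N *ᵥ x ≤ x ⬝ᵥ x := by
  have h := N.l2_opNorm_mulVec (WithLp.toLp 2 x)
  have h2 : ‖WithLp.toLp 2 (N *ᵥ x)‖ ≤ ‖WithLp.toLp 2 x‖ :=
    h.trans (mul_le_of_le_one_left (norm_nonneg _) hN)
  rw [← norm_sq_toLp, ← norm_sq_toLp]
  gcongr

theorem dotProduct_self_eq_sum {p : ℕ} (x : Fin p → ℝ) : x ⬝ᵥ x = ∑ j, x j ^ 2 := by
  simp [dotProduct, sq]

theorem dotProduct_mulVec_mulVec {p q r : ℕ} (F : Matrix (Fin p) (Fin q) ℝ)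
    (G : Matrix (Fin p) (Fin r) ℝ) (x : Fin q → ℝ) (z : Fin r → ℝ) :
    F *ᵥ x ⬝ᵥ G *ᵥ z = x ⬝ᵥ (Fᵀ * G) *ᵥ z := by
  rw [← vecMul_transpose, ← dotProduct_mulVec, mulVec_mulVec]

theorem isometry_dotProduct {p q : ℕ} {F : Matrix (Fin p) (Fin q) ℝ} (hF : Fᵀ * F = 1)
    (x z : Fin q → ℝ) : F *ᵥ x ⬝ᵥ F *ᵥ z = x ⬝ᵥ z := by
  rw [dotProduct_mulVec_mulVec, hF, one_mulVec]

variable {n : ℕ} {A U : Matrix (Fin n) (Fin n) ℝ} {l : Fin n → ℝ}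

theorem orthogonal_mul_transpose (hU : U ∈ Matrix.orthogonalGroup (Fin n) ℝ) : U * Uᵀ = 1 :=
  Matrix.mem_orthogonalGroup_iff _ _ |>.mp hU

theorem orthogonal_transpose_mul (hU : U ∈ Matrix.orthogonalGroup (Fin n) ℝ) : Uᵀ * U = 1 :=
  Matrix.mem_orthogonalGroup_iff' _ _ |>.mp hU

theorem coords_mulVec (hU : U ∈ Matrix.orthogonalGroup (Fin n) ℝ)
    (hAU : A = U * Matrix.diagonal l * Uᵀ) (v : Fin n → ℝ) (j : Fin n) :
    (Uᵀ *ᵥ A *ᵥ v) j = l j * (Uᵀ *ᵥ v) j := by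
  rw [hAU, mulVec_mulVec, Matrix.mul_assoc, ← Matrix.mul_assoc Uᵀ, orthogonal_transpose_mul hU,
    Matrix.one_mul, ← mulVec_mulVec, mulVec_diagonal]

theorem dotProduct_eq_sum_coords (hU : U ∈ Matrix.orthogonalGroup (Fin n) ℝ)
    (v w : Fin n → ℝ) : v ⬝ᵥ w = ∑ j, (Uᵀ *ᵥ v) j * (Uᵀ *ᵥ w) j := by
  have : (Uᵀ)ᵀ * Uᵀ = 1 := by rw [transpose_transpose, orthogonal_mul_transpose hU]
  rw [← isometry_dotProduct this]
  rfl

theorem form_eq_sum_coords (hU : U ∈ Matrix.orthogonalGroup (Fin n) ℝ)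
    (hAU : A = U * Matrix.diagonal l * Uᵀ) (v : Fin n → ℝ) :
    v ⬝ᵥ A *ᵥ v = ∑ j, l j * (Uᵀ *ᵥ v) j ^ 2 := by
  rw [dotProduct_eq_sum_coords hU]
  refine Finset.sum_congr rfl fun j _ => ?_
  rw [coords_mulVec hU hAU]
  ring

theorem normSq_mulVec_eq_sum_coords (hU : U ∈ Matrix.orthogonalGroup (Fin n) ℝ)
    (hAU : A = U * Matrix.diagonal l * Uᵀ) (v : Fin n → ℝ) :
    A *ᵥ v ⬝ᵥ A *ᵥ v = ∑ j, l j ^ 2 * (Uᵀ *ᵥ v) j ^ 2 := by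
  rw [dotProduct_eq_sum_coords hU]
  refine Finset.sum_congr rfl fun j _ => ?_
  rw [coords_mulVec hU hAU]
  ring

theorem normSq_eq_sum_coords (hU : U ∈ Matrix.orthogonalGroup (Fin n) ℝ) (v : Fin n → ℝ) :
    v ⬝ᵥ v = ∑ j, (Uᵀ *ᵥ v) j ^ 2 := by
  rw [dotProduct_eq_sum_coords hU]
  simp only [sq]

variable {k : ℕ} {hk : k < n} {ε : ℝ} {Q : Matrix (Fin n) (Fin k) ℝ}
  {M : Matrix (Fin k) (Fin k) ℝ} {N : Matrix (Fin (n - k)) (Fin k) ℝ}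

theorem transpose_mulVec_leadCols (hU : U ∈ Matrix.orthogonalGroup (Fin n) ℝ) (x : Fin k → ℝ)
    (j : Fin n) : (Uᵀ *ᵥ leadCols hk U *ᵥ x) j = ∑ i, (if j = i.castLE hk.le then x i else 0) := by
  have h := orthogonal_transpose_mul hU
  have h2 : ∀ i : Fin k, (Uᵀ * leadCols hk U) j i = (1 : Matrix (Fin n) (Fin n) ℝ) j (i.castLE hk.le) := by
    intro i
    rw [← h]
    rfl
  rw [mulVec_mulVec]
  simp [mulVec, dotProduct, h2, Matrix.one_apply]

theorem transpose_mulVec_tailCols (hU : U ∈ Matrix.orthogonalGroup (Fin n) ℝ)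
    (x : Fin (n - k) → ℝ) (j : Fin n) :
    (Uᵀ *ᵥ tailCols hk U *ᵥ x) j = ∑ c : Fin (n - k), (if j = ⟨k + c, by omega⟩ then x c else 0) := by
  have h := orthogonal_transpose_mul hU
  have h2 : ∀ c : Fin (n - k), (Uᵀ * tailCols hk U) j c =
      (1 : Matrix (Fin n) (Fin n) ℝ) j ⟨k + c, by omega⟩ := by
    intro i
    rw [← h]
    rfl
  rw [mulVec_mulVec]
  simp [mulVec, dotProduct, h2, Matrix.one_apply]

theorem mulVec_eq_of_decomposition (hQMN : Q = leadCols hk U + ε ^ 2 • (leadCols hk U * M)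
      + ε • (tailCols hk U * N)) (x : Fin k → ℝ) :
    Q *ᵥ x = leadCols hk U *ᵥ (x + ε ^ 2 • M *ᵥ x) + tailCols hk U *ᵥ (ε • N *ᵥ x) := by
  rw [hQMN]
  simp only [add_mulVec, smul_mulVec, mulVec_add, mulVec_smul, mulVec_mulVec]

theorem lead_coord (hU : U ∈ Matrix.orthogonalGroup (Fin n) ℝ)
    (hQMN : Q = leadCols hk U + ε ^ 2 • (leadCols hk U * M) + ε • (tailCols hk U * N))
    (x : Fin k → ℝ) (i : Fin k) :
    (Uᵀ *ᵥ Q *ᵥ x) (i.castLE hk.le) = x i + ε ^ 2 * (M *ᵥ x) i := by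
  rw [mulVec_eq_of_decomposition hQMN, mulVec_add, Pi.add_apply, transpose_mulVec_leadCols hU,
    transpose_mulVec_tailCols hU]
  have h : ∀ c : Fin (n - k), ¬ (i.castLE hk.le = ⟨k + c, by omega⟩) := by
    intro c hc
    have := congrArg Fin.val hc
    simp at this
    omega
  simp [h]

theorem tail_coord (hU : U ∈ Matrix.orthogonalGroup (Fin n) ℝ)
    (hQMN : Q = leadCols hk U + ε ^ 2 • (leadCols hk U * M) + ε • (tailCols hk U * N))
    (x : Fin k → ℝ) (c : Fin (n - k)) :
    (Uᵀ *ᵥ Q *ᵥ x) ⟨k + c, by omega⟩ = ε * (N *ᵥ x) c := by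
  rw [mulVec_eq_of_decomposition hQMN, mulVec_add, Pi.add_apply, transpose_mulVec_leadCols hU,
    transpose_mulVec_tailCols hU]
  have h : ∀ i : Fin k, ¬ ((⟨k + c, by omega⟩ : Fin n) = i.castLE hk.le) := by
    intro i hc
    have := congrArg Fin.val hc
    simp at this
    omega
  simp [h, ← Fin.ext_iff]

theorem sum_tail_coords_le (hU : U ∈ Matrix.orthogonalGroup (Fin n) ℝ)
    (hQMN : Q = leadCols hk U + ε ^ 2 • (leadCols hk U * M) + ε • (tailCols hk U * N))
    (hN : ‖N‖ ≤ 1) (x : Fin k → ℝ) :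
    ∑ c : Fin (n - k), (Uᵀ *ᵥ Q *ᵥ x) ⟨k + c, by omega⟩ ^ 2 ≤ ε ^ 2 * (x ⬝ᵥ x) := by
  simp only [tail_coord hU hQMN, mul_pow]
  rw [← Finset.mul_sum, ← dotProduct_self_eq_sum]
  exact mul_le_mul_of_nonneg_left (dotProduct_self_mulVec_le hN x) (sq_nonneg _)

/-- Since `Q` and `U` preserve norms, whatever mass of `x` is not in the tail must be in the lead;
no estimate on `M` enters. -/
theorem le_sum_lead_coords (hU : U ∈ Matrix.orthogonalGroup (Fin n) ℝ)
    (hQ : Qᵀ * Q = 1)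
    (hQMN : Q = leadCols hk U + ε ^ 2 • (leadCols hk U * M) + ε • (tailCols hk U * N))
    (hN : ‖N‖ ≤ 1) (x : Fin k → ℝ) :
    (1 - ε ^ 2) * (x ⬝ᵥ x) ≤ ∑ i : Fin k, (Uᵀ *ᵥ Q *ᵥ x) (i.castLE hk.le) ^ 2 := by
  have h1 := normSq_eq_sum_coords hU (Q *ᵥ x)
  rw [isometry_dotProduct hQ, sum_lead_add_tail hk] at h1
  have h2 := sum_tail_coords_le hU hQMN hN x
  linarith

end Coordinates

/-! ### Ritz values, singular values of `A Q`, eigenvalues of `A` -/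

section RayleighRitz

variable {n k : ℕ} {A : Matrix (Fin n) (Fin n) ℝ} {Q : Matrix (Fin n) (Fin k) ℝ}

theorem compress_form (x : Fin k → ℝ) :
    x ⬝ᵥ (Qᵀ * A * Q) *ᵥ x = Q *ᵥ x ⬝ᵥ A *ᵥ Q *ᵥ x := by
  rw [mulVec_mulVec _ A, dotProduct_mulVec_mulVec, Matrix.mul_assoc]

theorem gram_form {p q : ℕ} (C : Matrix (Fin p) (Fin q) ℝ) (x : Fin q → ℝ) :
    x ⬝ᵥ (Cᵀ * C) *ᵥ x = C *ᵥ x ⬝ᵥ C *ᵥ x :=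
  (dotProduct_mulVec_mulVec C C x x).symm

theorem isHermitian_gram {p q : ℕ} (C : Matrix (Fin p) (Fin q) ℝ) : (Cᵀ * C).IsHermitian :=
  Matrix.isHermitian_conjTranspose_mul_self C

theorem eigval_compress_nonneg (hA : A.PosSemidef) (i : Fin k) :
    0 ≤ eigval (compress_isHermitian hA.isHermitian Q) i := by
  refine le_eigval _ i 0 ⊤ (by simp) fun v _ => ?_
  rw [compress_form, zero_mul]
  exact hA.dotProduct_mulVec_nonneg _

/-- On the space where `v ⬝ᵥ A v ≥ μ‖v‖²` with `v = Q x`, expanding `‖A v - μ v‖² ≥ 0` gives `‖A v‖²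
≥ μ²‖v‖²`, using `μ ≥ 0`. -/
theorem eigval_compress_le_singval (hA : A.PosSemidef) (hQ : Qᵀ * Q = 1) (i : Fin k) :
    eigval (compress_isHermitian hA.isHermitian Q) i ≤ singval (A * Q) i := by
  set μ := eigval (compress_isHermitian hA.isHermitian Q) i with hμ
  have hμ0 : 0 ≤ μ := eigval_compress_nonneg hA i
  obtain ⟨W, hW, h⟩ := exists_submodule_eigval_le (compress_isHermitian hA.isHermitian Q) i
  refine le_of_sq_le_sq ?_ (singval_nonneg _ _)
  rw [sq_singval (A * Q) (isHermitian_gram _)]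
  refine le_eigval _ i _ W hW fun x hx => ?_
  rw [gram_form, ← mulVec_mulVec]
  have h1 := h x hx
  rw [compress_form, ← isometry_dotProduct hQ, ← hμ] at h1
  rw [← isometry_dotProduct hQ]
  set v := Q *ᵥ x
  have h2 : 0 ≤ (A *ᵥ v - μ • v) ⬝ᵥ (A *ᵥ v - μ • v) := by
    simpa using dotProduct_star_self_nonneg (A *ᵥ v - μ • v)
  simp only [sub_dotProduct, dotProduct_sub, smul_dotProduct, dotProduct_smul, smul_eq_mul,
    dotProduct_comm (A *ᵥ v) v] at h2
  nlinarith

/-- The space realising `σᵢ` contains some `x ≠ 0` for which `Q x` has no component along the first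
`i` eigenvectors; there `A` stretches by at most `lᵢ`. -/
theorem singval_le {U : Matrix (Fin n) (Fin n) ℝ} {l : Fin n → ℝ} (hl0 : ∀ j, 0 ≤ l j)
    (hl : Antitone l) (hU : U ∈ Matrix.orthogonalGroup (Fin n) ℝ)
    (hAU : A = U * Matrix.diagonal l * Uᵀ) (hkn : k ≤ n) (hQ : Qᵀ * Q = 1) (i : Fin k) :
    singval (A * Q) i ≤ l (i.castLE hkn) := by
  refine le_of_sq_le_sq ?_ (hl0 _)
  rw [sq_singval (A * Q) (isHermitian_gram _)]
  obtain ⟨W, hW, h⟩ := exists_submodule_eigval_le (isHermitian_gram (A * Q)) i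
  obtain ⟨x, hxW, hx0, hx⟩ := exists_ne_zero_vanishing_below (Uᵀ * Q).mulVecLin
    (i.castLE hkn) W hW
  have hpos : 0 < x ⬝ᵥ x := by
    refine lt_of_le_of_ne ?_ (Ne.symm (mt dotProduct_self_eq_zero.mp hx0))
    simpa using dotProduct_star_self_nonneg x
  refine le_of_mul_le_mul_right ((h x hxW).trans ?_) hpos
  rw [gram_form, ← mulVec_mulVec, normSq_mulVec_eq_sum_coords hU hAU, ← isometry_dotProduct hQ,
    normSq_eq_sum_coords hU, Finset.mul_sum]
  refine Finset.sum_le_sum fun j _ => ?_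
  rcases le_or_gt (i.castLE hkn) j with hj | hj
  · exact mul_le_mul_of_nonneg_right (pow_le_pow_left₀ (hl0 j) (hl hj) 2) (sq_nonneg _)
  · have := hx j hj
    rw [mulVecLin_apply, ← mulVec_mulVec] at this
    simp [this]

end RayleighRitz

end NystromEig

namespace NystromEig

open Module Matrix

/-! ### Lower bound for the Ritz values -/

section RayleighRitzLower

variable {n k : ℕ} {A U : Matrix (Fin n) (Fin n) ℝ} {l : Fin n → ℝ} {hk : k < n} {ε : ℝ}
  {Q : Matrix (Fin n) (Fin k) ℝ} {M : Matrix (Fin k) (Fin k) ℝ}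
  {N : Matrix (Fin (n - k)) (Fin k) ℝ}

/-- The test space is the span of the first `i + 1` standard vectors of `ℝᵏ`. The nonnegative tail
is dropped; each of the two quadratic error terms, in `x` and in `M x`, costs at most `ε² l₁ ‖x‖²`.
-/
theorem le_eigval_compress (hA : A.IsHermitian) (hl0 : ∀ j, 0 ≤ l j) (hl : Antitone l)
    {l₁ : ℝ} (hl₁ : ∀ j, l j ≤ l₁)
    (hU : U ∈ Matrix.orthogonalGroup (Fin n) ℝ) (hAU : A = U * Matrix.diagonal l * Uᵀ)
    (hM : ‖M‖ ≤ 1)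
    (hQMN : Q = leadCols hk U + ε ^ 2 • (leadCols hk U * M) + ε • (tailCols hk U * N))
    (i : Fin k) :
    l (i.castLE hk.le) - 2 * ε ^ 2 * l₁ ≤ eigval (compress_isHermitian hA Q) i := by
  refine le_eigval _ i _ (supportedUpTo LinearMap.id i)
    (lt_finrank_supportedUpTo (by simp) _ i) fun x hx => ?_
  rw [mem_supportedUpTo] at hx
  rw [compress_form, form_eq_sum_coords hU hAU, sum_lead_add_tail hk]
  have htail : 0 ≤ ∑ c : Fin (n - k), l ⟨k + c, by omega⟩ *
      (Uᵀ *ᵥ Q *ᵥ x) ⟨k + c, by omega⟩ ^ 2 :=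
    Finset.sum_nonneg fun c _ => mul_nonneg (hl0 _) (sq_nonneg _)
  have hM' := dotProduct_self_mulVec_le hM x
  have hlead : ∑ j : Fin k, ((l (i.castLE hk.le) - ε ^ 2 * l₁) * x j ^ 2
      - ε ^ 2 * l₁ * (M *ᵥ x) j ^ 2) ≤
      ∑ j : Fin k, l (j.castLE hk.le) * (Uᵀ *ᵥ Q *ᵥ x) (j.castLE hk.le) ^ 2 := by
    refine Finset.sum_le_sum fun j _ => ?_
    rw [lead_coord hU hQMN]
    set m := (M *ᵥ x) j
    have h1 : l (i.castLE hk.le) * x j ^ 2 ≤ l (j.castLE hk.le) * x j ^ 2 := by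
      rcases le_or_gt j i with h | h
      · exact mul_le_mul_of_nonneg_right (hl h) (sq_nonneg _)
      · have : x j = 0 := hx j h
        simp [this]
    have h2 : l (j.castLE hk.le) ≤ l₁ := hl₁ _
    -- The cross term of `(x j + ε² m)²` is controlled by `2 x m ≥ -(x² + m²)`.
    have h3 := mul_nonneg (mul_nonneg (sq_nonneg ε) (hl0 (j.castLE hk.le))) (sq_nonneg (x j + m))
    have h4 := mul_nonneg (mul_nonneg (sq_nonneg ε) (sub_nonneg.mpr h2))
      (add_nonneg (sq_nonneg (x j)) (sq_nonneg m))
    have h5 := mul_nonneg (hl0 (j.castLE hk.le)) (sq_nonneg (ε ^ 2 * m))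
    nlinarith
  rw [Finset.sum_sub_distrib, ← Finset.mul_sum, ← Finset.mul_sum, ← dotProduct_self_eq_sum,
    ← dotProduct_self_eq_sum] at hlead
  have := mul_le_mul_of_nonneg_left hM' (mul_nonneg (sq_nonneg ε) ((hl0 ⟨k, hk⟩).trans (hl₁ _)))
  linarith

end RayleighRitzLower

/-! ### Loewner and eigenvalue bounds for the Nyström approximation -/

section Nystrom

variable {n k : ℕ} {A : Matrix (Fin n) (Fin n) ℝ} {Q : Matrix (Fin n) (Fin k) ℝ}

theorem transpose_eq_of_isHermitian {p : ℕ} {B : Matrix (Fin p) (Fin p) ℝ}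
    (hB : B.IsHermitian) : Bᵀ = B := by
  rw [← conjTranspose_eq_transpose_of_trivial]
  exact hB

theorem mulVec_dotProduct {p q : ℕ} (F : Matrix (Fin p) (Fin q) ℝ) (x : Fin q → ℝ)
    (y : Fin p → ℝ) : F *ᵥ x ⬝ᵥ y = x ⬝ᵥ Fᵀ *ᵥ y := by
  rw [dotProduct_comm, dotProduct_mulVec, ← mulVec_transpose, dotProduct_comm]

/-- Expansion of the quadratic form of a symmetric matrix at a difference. -/
theorem form_sub_smul {p : ℕ} {B : Matrix (Fin p) (Fin p) ℝ} (hB : B.IsHermitian)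
    (v w : Fin p → ℝ) (s : ℝ) :
    (v - s • w) ⬝ᵥ B *ᵥ (v - s • w) =
      v ⬝ᵥ B *ᵥ v - 2 * s * (w ⬝ᵥ B *ᵥ v) + s ^ 2 * (w ⬝ᵥ B *ᵥ w) := by
  have h : v ⬝ᵥ B *ᵥ w = w ⬝ᵥ B *ᵥ v := by
    rw [dotProduct_comm, mulVec_dotProduct, transpose_eq_of_isHermitian hB]
  simp only [mulVec_sub, mulVec_smul, sub_dotProduct, dotProduct_sub, smul_dotProduct,
    dotProduct_smul, smul_eq_mul, h]
  ring

theorem compress_posSemidef (hA : A.PosSemidef) : (Qᵀ * A * Q).PosSemidef := by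
  rw [← conjTranspose_eq_transpose_of_trivial]
  exact hA.conjTranspose_mul_mul_same Q

/-- The range of `Qᵀ A` is contained in the range of `Qᵀ A Q`. -/
theorem compress_mul_pinv_mul (hA : A.PosSemidef) :
    Qᵀ * A * Q * pinv (Qᵀ * A * Q) * (Qᵀ * A) = Qᵀ * A := by
  set G := Qᵀ * A * Q with hG
  have hp := pinv_isPenrose G
  have hAT := transpose_eq_of_isHermitian hA.isHermitian
  -- For positive semidefinite `A`, a vector with vanishing form lies in the kernel; apply this to
  -- each column.
  have hzero : A * (Q * (1 - G * pinv G)) = 0 := by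
    refine ext_of_mulVec_single fun j => ?_
    rw [zero_mulVec, ← mulVec_mulVec, ← hA.dotProduct_mulVec_zero_iff, star_trivial,
      ← compress_form]
    have : (Q * (1 - G * pinv G))ᵀ * A * (Q * (1 - G * pinv G)) = 0 := by
      calc (Q * (1 - G * pinv G))ᵀ * A * (Q * (1 - G * pinv G))
          = (1 - G * pinv G)ᵀ * G * (1 - G * pinv G) := by
            rw [transpose_mul, hG]; simp only [Matrix.mul_assoc]
        _ = (G - G * pinv G * G) * (1 - G * pinv G) := by
            rw [transpose_sub, transpose_one, hp.bp, Matrix.sub_mul, Matrix.one_mul]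
        _ = 0 := by rw [hp.bpb, sub_self, Matrix.zero_mul]
    rw [this]
    simp
  have h := congrArg Matrix.transpose hzero
  rw [transpose_mul, transpose_mul, hAT, transpose_sub, transpose_one, hp.bp, transpose_zero,
    Matrix.mul_assoc, Matrix.sub_mul, Matrix.one_mul] at h
  exact (sub_eq_zero.mp h).symm

/-- The coefficients of the `A`-orthogonal projection of `z` onto the range of `Q`. -/
noncomputable def nystromCoeff (A : Matrix (Fin n) (Fin n) ℝ) (Q : Matrix (Fin n) (Fin k) ℝ)
    (z : Fin n → ℝ) : Fin k → ℝ :=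
  (pinv (Qᵀ * A * Q) * (Qᵀ * A)) *ᵥ z

theorem nystrom_form (hA : A.IsHermitian) (z : Fin n → ℝ) :
    z ⬝ᵥ nystrom A Q *ᵥ z = Q *ᵥ nystromCoeff A Q z ⬝ᵥ A *ᵥ z := by
  have hP := transpose_eq_of_isHermitian (pinv_isHermitian (compress_isHermitian hA Q))
  rw [nystromCoeff, mulVec_mulVec, mulVec_dotProduct, mulVec_mulVec]
  congr 2
  rw [nystrom]
  generalize pinv (Qᵀ * A * Q) = P at hP ⊢
  simp only [transpose_mul, hP, transpose_transpose, transpose_eq_of_isHermitian hA,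
    Matrix.mul_assoc]

theorem nystrom_form_eq_compress_form (hA : A.IsHermitian) (z : Fin n → ℝ) :
    z ⬝ᵥ nystrom A Q *ᵥ z =
      nystromCoeff A Q z ⬝ᵥ (Qᵀ * A * Q) *ᵥ nystromCoeff A Q z := by
  have hP := transpose_eq_of_isHermitian (pinv_isHermitian (compress_isHermitian hA Q))
  rw [nystromCoeff, mulVec_mulVec, mulVec_dotProduct, mulVec_mulVec]
  congr 2
  have h := (pinv_isPenrose (Qᵀ * A * Q)).pbp
  set G := Qᵀ * A * Q
  rw [nystrom]
  conv_lhs => rw [← h]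
  simp only [transpose_mul, hP, transpose_transpose, transpose_eq_of_isHermitian hA,
    Matrix.mul_assoc]

/-- The difference of the two forms is the `A`-form of the residual of `z` after its `A`-orthogonal
projection onto the range of `Q`. -/
theorem nystrom_form_le (hA : A.PosSemidef) (z : Fin n → ℝ) :
    z ⬝ᵥ nystrom A Q *ᵥ z ≤ z ⬝ᵥ A *ᵥ z := by
  have h := hA.dotProduct_mulVec_nonneg (z - (1 : ℝ) • Q *ᵥ nystromCoeff A Q z)
  rw [star_trivial, form_sub_smul hA.isHermitian, ← nystrom_form hA.isHermitian, ← compress_form,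
    ← nystrom_form_eq_compress_form hA.isHermitian] at h
  linarith

/-- Expands the nonnegative form of `QᵀAQ` at the projection coefficients minus `s x`. This bounds
the Nyström form below without any pseudoinverse. -/
theorem le_nystrom_form (hA : A.PosSemidef) (z : Fin n → ℝ) (x : Fin k → ℝ) (s : ℝ) :
    2 * s * (Q *ᵥ x ⬝ᵥ A *ᵥ z) - s ^ 2 * (Q *ᵥ x ⬝ᵥ A *ᵥ Q *ᵥ x) ≤ z ⬝ᵥ nystrom A Q *ᵥ z := by
  have hG := compress_posSemidef (Q := Q) hA
  have h := hG.dotProduct_mulVec_nonneg (nystromCoeff A Q z - s • x)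
  have h2 : x ⬝ᵥ (Qᵀ * A * Q) *ᵥ nystromCoeff A Q z = Q *ᵥ x ⬝ᵥ A *ᵥ z := by
    rw [nystromCoeff, mulVec_mulVec, ← Matrix.mul_assoc, compress_mul_pinv_mul hA,
      mulVec_dotProduct, mulVec_mulVec]
  rw [star_trivial, form_sub_smul hG.isHermitian, h2,
    ← nystrom_form_eq_compress_form hA.isHermitian, compress_form] at h
  linarith

theorem nystrom_form_nonneg (hA : A.PosSemidef) (z : Fin n → ℝ) :
    0 ≤ z ⬝ᵥ nystrom A Q *ᵥ z := by
  simpa using le_nystrom_form (Q := Q) hA z 0 0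

theorem eigval_nystrom_le (hA : A.PosSemidef) (i : Fin n) :
    eigval (nystrom_isHermitian hA.isHermitian Q) i ≤ eigval hA.isHermitian i := by
  obtain ⟨W, hW, h⟩ := exists_submodule_eigval_le (nystrom_isHermitian hA.isHermitian Q) i
  exact le_eigval _ i _ W hW fun v hv => (h v hv).trans (nystrom_form_le hA v)

/-- On the range of `A Q` the Nyström form dominates every lower bound of the Rayleigh quotient
of `A` on the range of `A^{1/2} Q`. -/
theorem le_nystrom_form_of_le (hA : A.PosSemidef) (x : Fin k → ℝ) (c : ℝ)
    (h : c * (Q *ᵥ x ⬝ᵥ A *ᵥ Q *ᵥ x) ≤ A *ᵥ Q *ᵥ x ⬝ᵥ A *ᵥ Q *ᵥ x) :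
    c * (A *ᵥ Q *ᵥ x ⬝ᵥ A *ᵥ Q *ᵥ x) ≤ A *ᵥ Q *ᵥ x ⬝ᵥ nystrom A Q *ᵥ A *ᵥ Q *ᵥ x := by
  have hb : 0 ≤ A *ᵥ Q *ᵥ x ⬝ᵥ A *ᵥ Q *ᵥ x := by
    simpa using dotProduct_star_self_nonneg (A *ᵥ Q *ᵥ x)
  rcases le_total c 0 with hc | hc
  · exact (mul_nonpos_of_nonpos_of_nonneg hc hb).trans (nystrom_form_nonneg hA _)
  -- With `s = c`, the hypothesis bounds the quadratic term by half of the linear one.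
  · have h1 := le_nystrom_form (Q := Q) hA (A *ᵥ Q *ᵥ x) x c
    have h2 : Q *ᵥ x ⬝ᵥ A *ᵥ A *ᵥ Q *ᵥ x = A *ᵥ Q *ᵥ x ⬝ᵥ A *ᵥ Q *ᵥ x := by
      rw [mulVec_dotProduct A, transpose_eq_of_isHermitian hA.isHermitian]
    rw [h2] at h1
    have h3 := mul_le_mul_of_nonneg_left h hc
    nlinarith

/-- Test on `A Q x`, where the lead coordinates of `Q x` after `i` vanish. It suffices that `‖A v‖²
≥ (lᵢ - δ)(v ⬝ᵥ A v)` for `v = Q x`: the lead gains at least `lᵢ δ (1 - ε²)‖x‖²` and the tail loses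
at most `l_{k+1} lᵢ ε²‖x‖²`. -/
theorem le_eigval_nystrom (hA : A.PosSemidef) {U : Matrix (Fin n) (Fin n) ℝ} {l : Fin n → ℝ}
    {hk : k < n} {ε : ℝ} {M : Matrix (Fin k) (Fin k) ℝ} {N : Matrix (Fin (n - k)) (Fin k) ℝ}
    (hl0 : ∀ j, 0 ≤ l j) (hl : Antitone l)
    (hU : U ∈ Matrix.orthogonalGroup (Fin n) ℝ) (hAU : A = U * Matrix.diagonal l * Uᵀ)
    (hε : ε ^ 2 < 1) (hN : ‖N‖ ≤ 1) (hQ : Qᵀ * Q = 1)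
    (hQMN : Q = leadCols hk U + ε ^ 2 • (leadCols hk U * M) + ε • (tailCols hk U * N))
    (i : Fin k) (hi : 0 < l (i.castLE hk.le)) :
    l (i.castLE hk.le) - l ⟨k, hk⟩ * ε ^ 2 / (1 - ε ^ 2) ≤
      eigval (nystrom_isHermitian hA.isHermitian Q) (i.castLE hk.le) := by
  set f : (Fin k → ℝ) →ₗ[ℝ] (Fin k → ℝ) :=
    LinearMap.funLeft ℝ ℝ (Fin.castLE hk.le) ∘ₗ (Uᵀ * Q).mulVecLin
  have hf : ∀ x j, f x j = (Uᵀ *ᵥ Q *ᵥ x) (j.castLE hk.le) := by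
    intro x j
    rw [mulVec_mulVec]
    rfl
  have hε' : 0 < 1 - ε ^ 2 := sub_pos.mpr hε
  -- This `δ` makes the lead gain and the tail loss balance exactly.
  set δ := l ⟨k, hk⟩ * ε ^ 2 / (1 - ε ^ 2) with hδ
  have hδ0 : 0 ≤ δ := div_nonneg (mul_nonneg (hl0 _) (sq_nonneg _)) hε'.le
  have hδ' : δ * (1 - ε ^ 2) = l ⟨k, hk⟩ * ε ^ 2 := div_mul_cancel₀ _ hε'.ne'
  refine le_eigval_of_map _ _ _ (A * Q) (supportedUpTo f i)
    (lt_finrank_supportedUpTo (by simp) f i) ?_ ?_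
  -- Injectivity: `A Q x = 0` and `lᵢ > 0` kill the lead coordinates up to `i`, the test space kills
  -- the others, and the lead mass bound forces `x = 0`.
  · intro x hx h0
    rw [mem_supportedUpTo] at hx
    rw [← mulVec_mulVec] at h0
    have hlead : ∀ j : Fin k, (Uᵀ *ᵥ Q *ᵥ x) (j.castLE hk.le) = 0 := by
      intro j
      rcases le_or_gt j i with h | h
      · have h1 := coords_mulVec hU hAU (Q *ᵥ x) (j.castLE hk.le)
        rw [h0, mulVec_zero, Pi.zero_apply] at h1
        exact (mul_eq_zero.mp h1.symm).resolve_left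
          (hi.trans_le (hl (show j.castLE hk.le ≤ i.castLE hk.le from h))).ne'
      · rw [← hf, hx j h]
    have h2 := le_sum_lead_coords hU hQ hQMN hN x
    simp only [hlead] at h2
    rw [← dotProduct_self_eq_zero]
    have h3 : 0 ≤ x ⬝ᵥ x := by simpa using dotProduct_star_self_nonneg x
    refine le_antisymm ?_ h3
    by_contra hcon
    have := mul_pos hε' (not_le.mp hcon)
    simp at h2
    linarith
  · intro x hx
    rw [mem_supportedUpTo] at hx
    rw [← mulVec_mulVec]
    refine le_nystrom_form_of_le hA x _ ?_
    rw [form_eq_sum_coords hU hAU, normSq_mulVec_eq_sum_coords hU hAU, ← sub_nonneg,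
      Finset.mul_sum, ← Finset.sum_sub_distrib, sum_lead_add_tail hk]
    set y := Uᵀ *ᵥ Q *ᵥ x
    set li := l (i.castLE hk.le) with hli
    have hlead : ∑ j : Fin k, li * δ * y (j.castLE hk.le) ^ 2 ≤
        ∑ j : Fin k, (l (j.castLE hk.le) ^ 2 * y (j.castLE hk.le) ^ 2 -
          (li - δ) * (l (j.castLE hk.le) * y (j.castLE hk.le) ^ 2)) := by
      refine Finset.sum_le_sum fun j _ => ?_
      rcases le_or_gt j i with h | h
      · have h1 : li ≤ l (j.castLE hk.le) := hl h
        have h2 : li * δ ≤ l (j.castLE hk.le) * (l (j.castLE hk.le) - (li - δ)) :=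
          mul_le_mul h1 (by linarith) hδ0 (hl0 _)
        nlinarith [mul_le_mul_of_nonneg_right h2 (sq_nonneg (y (j.castLE hk.le)))]
      · have : y (j.castLE hk.le) = 0 := (hf x j).symm.trans (hx j h)
        simp [this]
    have htail : ∑ c : Fin (n - k), -(l ⟨k, hk⟩ * li) * y ⟨k + c, by omega⟩ ^ 2 ≤
        ∑ c : Fin (n - k), (l ⟨k + c, by omega⟩ ^ 2 * y ⟨k + c, by omega⟩ ^ 2 -
          (li - δ) * (l ⟨k + c, by omega⟩ * y ⟨k + c, by omega⟩ ^ 2)) := by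
      refine Finset.sum_le_sum fun c _ => ?_
      have h1 : l ⟨k + c, by omega⟩ ≤ l ⟨k, hk⟩ := hl (Nat.le_add_right k c)
      have h0 := hl0 ⟨k + c, by omega⟩
      have h2 : -(l ⟨k, hk⟩ * li) ≤ l ⟨k + c, by omega⟩ * (l ⟨k + c, by omega⟩ - (li - δ)) := by
        nlinarith [mul_le_mul_of_nonneg_right h1 hi.le, mul_nonneg h0 hδ0, mul_nonneg h0 h0]
      nlinarith [mul_le_mul_of_nonneg_right h2 (sq_nonneg (y ⟨k + c, by omega⟩))]
    rw [← Finset.mul_sum] at hlead htail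
    have h1 := mul_le_mul_of_nonneg_left (le_sum_lead_coords hU hQ hQMN hN x)
      (mul_nonneg hi.le hδ0)
    have h2 := mul_le_mul_of_nonneg_left (sum_tail_coords_le hU hQMN hN x)
      (mul_nonneg (hl0 ⟨k, hk⟩) hi.le)
    have h3 : li * δ * ((1 - ε ^ 2) * (x ⬝ᵥ x)) = l ⟨k, hk⟩ * li * (ε ^ 2 * (x ⬝ᵥ x)) := by
      linear_combination li * (x ⬝ᵥ x) * hδ'
    linarith

end Nystrom

/-! ### Comparison with the stated constants -/

section Constants

theorem cRR_le_four {ε a t : ℝ} (hε0 : 0 ≤ ε) (hε1 : ε < 1) (ht : 0 ≤ t) (hta : t ≤ a) :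
    cRR ε a t ≤ 4 := by
  have h1 : t / a ≤ 1 := div_le_one_of_le₀ hta (ht.trans hta)
  have h2 : ε ^ 2 ≤ 1 := pow_le_one₀ hε0 hε1.le
  unfold cRR
  linarith

/-- The base of the square has numerator at least `li` and positive denominator at most `li (1 -
ε²)`. So it is at least `1 / (1 - ε²) ≥ 1`, and squaring only increases it. -/
theorem one_div_le_cNys {ε a t li : ℝ} (hε0 : 0 ≤ ε) (hε1 : ε < 1) (ht : 0 ≤ t)
    (hla : li ≤ a) (hli : 0 < li) (hα : 0 < alpha ε a t li) :
    1 / (1 - ε ^ 2) ≤ cNys ε a t li := by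
  have hε2 : ε ^ 2 < 1 := pow_lt_one₀ hε0 hε1 two_ne_zero
  have hden : alpha ε a t li * li = li - (3 * t + 3 * ε ^ 2 * (a - t)) := by
    unfold alpha
    field_simp
  have hdpos : 0 < li - (3 * t + 3 * ε ^ 2 * (a - t)) := hden ▸ mul_pos hα hli
  have hd : li - (3 * t + 3 * ε ^ 2 * (a - t)) ≤ li * (1 - ε ^ 2) := by
    nlinarith [mul_nonneg ht (sub_nonneg.mpr hε2.le),
      mul_nonneg (sq_nonneg ε) (sub_nonneg.mpr hla), mul_nonneg (sq_nonneg ε) hli.le]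
  have hnum : li ≤ a * (1 + ε ^ 2) + t * (1 + ε ^ 2 * (1 / (1 + √(1 - ε ^ 2)))) := by
    have h1 : 0 ≤ t * (1 + ε ^ 2 * (1 / (1 + √(1 - ε ^ 2)))) := by positivity
    nlinarith [mul_nonneg (sq_nonneg ε) (hli.le.trans hla)]
  have hpos : 0 < 1 - ε ^ 2 := sub_pos.mpr hε2
  have h1 : 1 / (1 - ε ^ 2) ≤ (a * (1 + ε ^ 2) + t * (1 + ε ^ 2 * (1 / (1 + √(1 - ε ^ 2))))) /
      (alpha ε a t li * li) := by
    rw [hden, div_le_div_iff₀ hpos hdpos, one_mul]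
    exact hd.trans (mul_le_mul_of_nonneg_right hnum hpos.le)
  have h2 : 1 ≤ 1 / (1 - ε ^ 2) := by
    rw [le_div_iff₀ hpos]
    linarith [sq_nonneg ε]
  exact h1.trans (le_self_pow₀ (h2.trans h1) two_ne_zero)

end Constants

end NystromEig

/-! ### Assembly of the error bounds -/

theorem theorem3p3 (n k : ℕ) (hk : k < n)
    (A : Matrix (Fin n) (Fin n) ℝ) (hA : A.PosSemidef)
    (l : Fin n → ℝ) (hl : l = NystromEig.eigval hA.isHermitian)
    (U : Matrix (Fin n) (Fin n) ℝ) (hU : U ∈ Matrix.orthogonalGroup (Fin n) ℝ)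
    (hAU : A = U * Matrix.diagonal l * Uᵀ)
    (ε : ℝ) (hε0 : 0 ≤ ε) (hε1 : ε < 1)
    (Q : Matrix (Fin n) (Fin k) ℝ) (hQ : Qᵀ * Q = 1)
    (M : Matrix (Fin k) (Fin k) ℝ) (N : Matrix (Fin (n - k)) (Fin k) ℝ)
    (hM : ‖M‖ ≤ 1) (hN : ‖N‖ ≤ 1)
    (hQMN : Q = NystromEig.leadCols hk U + ε ^ 2 • (NystromEig.leadCols hk U * M)
      + ε • (NystromEig.tailCols hk U * N)) :
    NystromEig.cRR ε (l ⟨0, by omega⟩) (l ⟨k, hk⟩) ≤ 4 ∧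
    ∀ i : Fin k,
      |l (i.castLE hk.le) - NystromEig.singval (A * Q) i| ≤
          |l (i.castLE hk.le) -
            NystromEig.eigval (NystromEig.compress_isHermitian hA.isHermitian Q) i| ∧
      |l (i.castLE hk.le) -
          NystromEig.eigval (NystromEig.compress_isHermitian hA.isHermitian Q) i| ≤
        NystromEig.cRR ε (l ⟨0, by omega⟩) (l ⟨k, hk⟩) * ε ^ 2 * l ⟨0, by omega⟩ ∧
      (0 < l (i.castLE hk.le) →
        0 < NystromEig.alpha ε (l ⟨0, by omega⟩) (l ⟨k, hk⟩) (l (i.castLE hk.le)) →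
        |l (i.castLE hk.le) -
            NystromEig.eigval (NystromEig.nystrom_isHermitian hA.isHermitian Q)
              (i.castLE hk.le)| ≤
          NystromEig.cNys ε (l ⟨0, by omega⟩) (l ⟨k, hk⟩) (l (i.castLE hk.le)) *
            (ε ^ 2 * l ⟨k, hk⟩ + ε ^ 4 * (l ⟨0, by omega⟩ - l ⟨k, hk⟩))) := by

  have hl0 : ∀ j, 0 ≤ l j := by
    intro j
    rw [hl]
    refine NystromEig.le_eigval _ j 0 ⊤ (by simp) fun v _ => ?_
    rw [zero_mul]
    exact hA.dotProduct_mulVec_nonneg v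
  have hanti : Antitone l := hl ▸ NystromEig.eigval_antitone hA.isHermitian
  have hε2 : ε ^ 2 < 1 := pow_lt_one₀ hε0 hε1 two_ne_zero
  have hk0 : l ⟨k, hk⟩ ≤ l ⟨0, by omega⟩ := hanti (Nat.zero_le _)
  refine ⟨NystromEig.cRR_le_four hε0 hε1 (hl0 _) hk0, fun i => ?_⟩
  have hμσ := NystromEig.eigval_compress_le_singval hA hQ i
  have hσl := NystromEig.singval_le hl0 hanti hU hAU hk.le hQ i
  refine ⟨?_, ?_, fun hi hα => ?_⟩
  · rw [abs_of_nonneg (sub_nonneg.mpr hσl), abs_of_nonneg (sub_nonneg.mpr (hμσ.trans hσl))]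
    exact sub_le_sub_left hμσ _
  · rw [abs_of_nonneg (sub_nonneg.mpr (hμσ.trans hσl))]
    have h := NystromEig.le_eigval_compress hA.isHermitian hl0 hanti
      (l₁ := l ⟨0, by omega⟩) (fun j => hanti (Nat.zero_le _)) hU hAU hM hQMN i
    -- This also covers `A = 0`, where the quotient is `0` by convention.
    have hC : 2 ≤ NystromEig.cRR ε (l ⟨0, by omega⟩) (l ⟨k, hk⟩) := by
      unfold NystromEig.cRR
      linarith [sq_nonneg ε, div_nonneg (hl0 ⟨k, hk⟩) (hl0 ⟨0, by omega⟩)]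
    have h2 := mul_le_mul_of_nonneg_right hC
      (mul_nonneg (sq_nonneg ε) (hl0 ⟨0, by omega⟩))
    linarith
  · have hle : NystromEig.eigval (NystromEig.nystrom_isHermitian hA.isHermitian Q)
        (i.castLE hk.le) ≤ l (i.castLE hk.le) := by
      rw [hl]
      exact NystromEig.eigval_nystrom_le hA _
    rw [abs_of_nonneg (sub_nonneg.mpr hle)]
    have h := NystromEig.le_eigval_nystrom hA hl0 hanti hU hAU hε2 hN hQ hQMN i hi
    have hC := NystromEig.one_div_le_cNys hε0 hε1 (hl0 ⟨k, hk⟩)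
      (hanti (Nat.zero_le _)) hi hα
    have hC0 : 0 ≤ NystromEig.cNys ε (l ⟨0, by omega⟩) (l ⟨k, hk⟩) (l (i.castLE hk.le)) :=
      sq_nonneg _
    have h1 := mul_le_mul_of_nonneg_right hC (mul_nonneg (sq_nonneg ε) (hl0 ⟨k, hk⟩))
    have h2 := mul_nonneg hC0 (mul_nonneg (pow_nonneg hε0 4) (sub_nonneg.mpr hk0))
    have h3 : 1 / (1 - ε ^ 2) * (ε ^ 2 * l ⟨k, hk⟩) = l ⟨k, hk⟩ * ε ^ 2 / (1 - ε ^ 2) := by ring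
    linarith
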